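/- Let $\mathcal V$ be a finite set of time series. A full-time causal graph (FTCG) with maximal lag $\gamma_{\max}\in\mathbb N$ is a directed acyclic graph $\mathcal G^f$ on the vertices $Z_s$ ($Z\in\mathcal V$, $s\in\mathbb Z$) whose edges $Z_{s}\to W_{r}$ satisfy $0\le r-s\le\gamma_{\max}$ and are invariant under time shifts. The extended summary causal graph (ESCG) derived from $\mathcal G^f$ has two vertices $Z_{t^-},Z_t$ for each $Z\in\mathcal V$, the edge $Z_t\to W_t$ iff $Z_t\to W_t$ in $\mathcal G^f$, the edge $Z_{t^-}\to W_t$ iff $Z_{t-\ell}\to W_t$ in $\mathcal G^f$ for some $1\le\ell\le\gamma_{\max}$, and no other edges. The candidate FTCGs of an ESCG $\mathcal G^e$ are those from which $\mathcal G^e$ is derived. A dynamic structural causal model (DSCM) with FTCG $\mathcal G^f$ consists of random variables $Z_s=f_Z(\mathrm{Par}(Z_s,\mathcal G^f),U_{Z,s})$ (almost surely) with values in standard Borel spaces, where the measurable mechanisms $f_Z$ and the laws of the noise variables $U_{Z,s}$ do not depend on $s$ (consistency throughout time), all the noise variables are jointly independent (causal sufficiency), and, for each $s$, the noise variables of times $\ge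 s$ are jointly independent of the observed variables of times $<s$. Let $P$ be the law of the observed variables. It is assumed to be positive: for fixed $\sigma$-finite reference measures $\nu_Z$ on the value spaces (e.g. counting or Lebesgue measures), every finite-dimensional marginal of $P$ has an almost everywhere positive density with respect to the product of the corresponding reference measures. The total effect $P(y_t\mid do(x_{t-\gamma}))$ is the law of $Y_t$ when $X_{t-\gamma}$ is held at the value $x_{t-\gamma}$, all variables of times before $t-\gamma$ are unchanged, and all other variables from time $t-\gamma$ on follow their structural equations. Theorem (Identifiability in ESCG). Let $\mathcal G^e$ be an ESCG over $\mathcal V$ with maximal lag $\gamma_{\max}$, let $X,Y\in\mathcal V$, $t\in\mathbb Z$ and $\gamma\ge 0$. Then $P(y_t\mid do(x_{t-\gamma}))$ is identifiable in $\mathcal G^e$: there is a functional of the observational law $P$ alone, the same for all candidate FTCGs of $\mathcal G^e$ and all DSCMs with positive law over them, that gives $P(y_t\mid do(x_{t-\gamma}))$ for $\nu_X$-almost every $x_{t-\gamma}$. Furthermore, the set $$\mathcal B_\gamma=\{Z_{t-\gamma-\ell} : 1\le\ell\le\gamma_{\max},\ Z_{t^-}\in \mathrm{Par}(X_t,\mathcal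 G^e)\}\cup\{Z_{t-\gamma} : Z_t\in \mathrm{Par}(X_t,\mathcal G^e)\}$$ is a valid adjustment set: in every DSCM with positive law over every candidate FTCG of $\mathcal G^e$, for $\nu_X$-almost every $x_{t-\gamma}$, $$P(y_t\mid do(x_{t-\gamma}))=\int P(y_t\mid x_{t-\gamma},\mathbf b)\,dP(\mathbf b),$$ where $\mathbf b$ ranges over the values of $\mathcal B_\gamma$. For countable value spaces with counting reference measures this says that, for every $x_{t-\gamma}$ and $y_t$, $P(y_t\mid do(x_{t-\gamma}))=\sum_{\mathbf b}P(y_t\mid x_{t-\gamma},\mathbf b)P(\mathbf b)$. -/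

import Mathlib

open MeasureTheory ProbabilityTheory

universe u v w

/-- A full-time causal graph over the time series `ι`, with maximal temporal lag `γmax`.  The vertex
`(i, s)` is the instance of the series `i` at time `s`.  The graph is acyclic, causes do not come
after their effects, lags are at most `γmax`, and edges are invariant under time shifts
(consistency throughout time of the causal relations). -/
structure FTCG (ι : Type u) (γmax : ℕ) extends Digraph (ι × ℤ) where
  time_le : ∀ {i j : ι} {s r : ℤ}, Adj (i, s) (j, r) → s ≤ r
  lag_le : ∀ {i j : ι} {s r : ℤ}, Adj (i, s) (j, r) → r - s ≤ γmax
  shift : ∀ {i j : ι} {s r : ℤ} (k : ℤ), Adj (i, s) (j, r) → Adj (i, s + k) (j, r + k)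
  acyclic : ∀ v, ¬ Relation.TransGen Adj v v

/-- The vertices of an extended summary causal graph: `past i` is `i_{t⁻}`, `present i` is `i_t`. -/
inductive ESCGVertex (ι : Type u) : Type u
  | past (i : ι)
  | present (i : ι)

/-- The extended summary causal graph derived from a full-time causal graph. By invariance under
time shifts the present can be placed at time `0`. -/
def FTCG.toESCG {ι : Type u} {γmax : ℕ} (G : FTCG ι γmax) : Digraph (ESCGVertex ι) where
  Adj
    | .past i, .present j => ∃ ℓ : ℕ, 0 < ℓ ∧ ℓ ≤ γmax ∧ G.Adj (i, -(ℓ : ℤ)) (j, 0)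
    | .present i, .present j => G.Adj (i, 0) (j, 0)
    | _, .past _ => False

/-- The candidate full-time causal graphs of `Ge`: those from which `Ge` is derived. -/
def candidateFTCGs {ι : Type u} (γmax : ℕ) (Ge : Digraph (ESCGVertex ι)) : Set (FTCG ι γmax) :=
  {G | G.toESCG = Ge}

/-- The (series, lag) pairs of the parents of the series `i` in a full-time causal graph. -/
abbrev FTCG.Parent {ι : Type u} {γmax : ℕ} (G : FTCG ι γmax) (i : ι) : Type u :=
  {p : ι × ℕ // G.Adj (p.1, -(p.2 : ℤ)) (i, 0)}

/-- Trajectories of a family of time series, the series `i` taking values in `S i`. -/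
abbrev Trajectory {ι : Type u} (S : ι → Type v) : Type (max u v) := ∀ q : ι × ℤ, S q.1

/-- A dynamic structural causal model with full-time causal graph `G`, with its random variables.

* Consistency throughout time: the mechanism and the noise law of a series do not depend on time.
* Causal sufficiency: all the noise variables are jointly independent.
* Since time has no beginning, the structural equations do not determine the joint law. The process
  is required to be generated forward in time: from any time `s` on, the noise is independent of
  the values taken before `s`. -/
structure DSCM {ι : Type u} {γmax : ℕ} (G : FTCG ι γmax) (𝒳 : ι → Type v)
    [∀ i, MeasurableSpace (𝒳 i)] where
  /-- values of the noise of each series -/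
  Noise : ι → Type w
  [noiseMeasurableSpace : ∀ i, MeasurableSpace (Noise i)]
  /-- law of the noise of each series -/
  noiseLaw : ∀ i, Measure (Noise i)
  /-- structural functions: arguments are the values of the parents and the noise -/
  mechanism : ∀ i, (∀ p : G.Parent i, 𝒳 p.1.1) → Noise i → 𝒳 i
  measurable_mechanism : ∀ i, Measurable (Function.uncurry (mechanism i))
  /-- the underlying probability space -/
  Ω : Type w
  [measurableSpaceΩ : MeasurableSpace Ω]
  μ : Measure Ω
  [isProbabilityMeasure : IsProbabilityMeasure μ]
  /-- the noise variables -/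
  U : ∀ q : ι × ℤ, Ω → Noise q.1
  /-- the observed variables -/
  V : ∀ q : ι × ℤ, Ω → 𝒳 q.1
  measurable_U : ∀ q, Measurable (U q)
  measurable_V : ∀ q, Measurable (V q)
  map_U : ∀ q, μ.map (U q) = noiseLaw q.1
  iIndepFun_U : iIndepFun U μ
  indepFun_past : ∀ s : ℤ,
    IndepFun (fun ω (q : {q : ι × ℤ // s ≤ q.2}) => U q.1 ω)
      (fun ω (q : {q : ι × ℤ // q.2 < s}) => V q.1 ω) μ
  structural_eq : ∀ (i : ι) (s : ℤ), ∀ᵐ ω ∂μ,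
    V (i, s) ω = mechanism i (fun p => V (p.1.1, s - p.1.2) ω) (U (i, s) ω)

attribute [instance] DSCM.noiseMeasurableSpace DSCM.measurableSpaceΩ DSCM.isProbabilityMeasure

/-- Following edges backwards without going before time `s` always terminates. -/
theorem FTCG.wellFounded_from {ι : Type u} [Finite ι] {γmax : ℕ} (G : FTCG ι γmax) (s : ℤ) :
    WellFounded (fun p q : ι × ℤ => G.Adj p q ∧ s ≤ p.2) := by
  have key : ∀ (T : ℤ), ∀ q : {q : ι × ℤ // s ≤ q.2 ∧ q.2 ≤ T},
      Acc (fun p q : ι × ℤ => G.Adj p q ∧ s ≤ p.2) q.1 := by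
    intro T
    have : Finite {q : ι × ℤ // s ≤ q.2 ∧ q.2 ≤ T} := by
      have h : (Set.univ ×ˢ Set.Icc s T : Set (ι × ℤ)).Finite :=
        Set.finite_univ.prod (Set.finite_Icc s T)
      exact (h.subset (fun q hq => ⟨trivial, hq⟩) : {q : ι × ℤ | s ≤ q.2 ∧ q.2 ≤ T}.Finite)
    let R : {q : ι × ℤ // s ≤ q.2 ∧ q.2 ≤ T} → {q : ι × ℤ // s ≤ q.2 ∧ q.2 ≤ T} → Prop :=
      fun p q => Relation.TransGen G.Adj p.1 q.1
    have : IsTrans _ R := ⟨fun _ _ _ h h' => Relation.TransGen.trans h h'⟩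
    have : Std.Irrefl R := ⟨fun q => G.acyclic q.1⟩
    have wf : WellFounded R := Finite.wellFounded_of_trans_of_irrefl R
    intro q
    induction q using wf.induction with
    | _ q ih =>
      refine Acc.intro _ fun p hp => ?_
      exact ih ⟨p, hp.2, (G.time_le hp.1).trans q.2.2⟩ (Relation.TransGen.single hp.1)
  refine ⟨fun q => Acc.intro _ fun p hp => ?_⟩
  exact key p.2 ⟨p, hp.2, le_rfl⟩

theorem FTCG.adj_of_parent {ι : Type u} {γmax : ℕ} (G : FTCG ι γmax) {i : ι} (p : G.Parent i)
    (s : ℤ) : G.Adj (p.1.1, s - p.1.2) (i, s) := by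
  have h := G.shift s p.2
  rwa [zero_add, neg_add_eq_sub] at h

namespace DSCM

variable {ι : Type u} {γmax : ℕ} {G : FTCG ι γmax} {𝒳 : ι → Type v} [∀ i, MeasurableSpace (𝒳 i)]

/-- The observational law: the joint law of all the observed variables. -/
noncomputable def obsLaw (M : DSCM.{u, v, w} G 𝒳) : Measure (Trajectory 𝒳) :=
  M.μ.map (fun ω q => M.V q ω)

instance (M : DSCM.{u, v, w} G 𝒳) : IsProbabilityMeasure M.obsLaw :=
  Measure.isProbabilityMeasure_map (measurable_pi_lambda _ M.measurable_V).aemeasurable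

open Classical in
/-- The trajectory under the intervention that sets the variable at the vertex `c` to the value `x`,
with given past and noise: nothing changes before the time of `c`; from that time on, all
variables obey their structural equations, except the one at `c`, which is held at `x`. -/
noncomputable def intervene [Finite ι] (M : DSCM.{u, v, w} G 𝒳) (c : ι × ℤ) (x : 𝒳 c.1)
    (past : Trajectory 𝒳) (noise : Trajectory M.Noise) : Trajectory 𝒳 :=
  (G.wellFounded_from c.2).fix fun q W =>
    if h : q = c then h ▸ x
    else if q.2 < c.2 then past q
    else M.mechanism q.1
      (fun p =>
        if hp : c.2 ≤ q.2 - p.1.2 then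
          W (p.1.1, q.2 - p.1.2) ⟨G.adj_of_parent p q.2, hp⟩
        else past (p.1.1, q.2 - p.1.2))
      (noise q)

/-- The total effect `P(Y | do(X = x))` for the variables `X` and `Y` at the vertices `c` and `d`:
the law of `Y` under the intervention that sets `X` to `x`. -/
noncomputable def totalEffect [Finite ι] (M : DSCM.{u, v, w} G 𝒳) (c d : ι × ℤ) (x : 𝒳 c.1) :
    Measure (𝒳 d.1) :=
  M.μ.map (fun ω => M.intervene c x (fun q => M.V q ω) (fun q => M.U q ω) d)

end DSCM

section

variable {ι : Type u} {𝒳 : ι → Type v} [∀ i, MeasurableSpace (𝒳 i)]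

/-- `P` is positive with respect to the reference measures `ν` (e.g. counting measure for discrete
series, Lebesgue measure for continuous ones): each finite-dimensional marginal has a density
with respect to the product of the reference measures, which is almost everywhere positive. -/
def IsPositiveLaw (ν : ∀ i, Measure (𝒳 i)) (P : Measure (Trajectory 𝒳)) : Prop :=
  ∀ (S : Set (ι × ℤ)) [Fintype S],
    (P.map fun τ (q : S) => τ q) ≪ Measure.pi (fun q : S => ν q.1.1) ∧
    Measure.pi (fun q : S => ν q.1.1) ≪ (P.map fun τ (q : S) => τ q)

/-- The right-hand side `∑_z P(y | x, z) P(z)` of the adjustment formula for the vertices `c` (of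
`x`) and `d` (of `y`) and the set `B` of adjustment vertices, as a measure in `y`: the mixture
over `z`, drawn from the law of the variables in `B`, of the conditional laws given `(x, z)`. -/
noncomputable def adjustmentFormula (P : Measure (Trajectory 𝒳)) [IsFiniteMeasure P]
    (c d : ι × ℤ) [StandardBorelSpace (𝒳 d.1)] [Nonempty (𝒳 d.1)] (B : Set (ι × ℤ)) (x : 𝒳 c.1) :
    Measure (𝒳 d.1) :=
  (P.map fun τ (q : B) => τ q).bind fun z =>
    condDistrib (fun τ : Trajectory 𝒳 => τ d) (fun τ => (τ c, fun q : B => τ q)) P (x, z)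

/-- For countably many discrete states this is literally `∑_z P(y | x, z) P(z)`. -/
theorem adjustmentFormula_singleton_of_countable [∀ i, Countable (𝒳 i)]
    [∀ i, MeasurableSingletonClass (𝒳 i)] (P : Measure (Trajectory 𝒳)) [IsFiniteMeasure P]
    (c d : ι × ℤ) [StandardBorelSpace (𝒳 d.1)] [Nonempty (𝒳 d.1)] (B : Set (ι × ℤ)) [Finite B]
    (x : 𝒳 c.1) (y : 𝒳 d.1)
    (hpos : ∀ z : ∀ q : B, 𝒳 q.1.1, P {τ | τ c = x ∧ ∀ q : B, τ q = z q} ≠ 0) :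
    adjustmentFormula P c d B x {y} = ∑' z : (∀ q : B, 𝒳 q.1.1),
      P {τ | τ d = y ∧ τ c = x ∧ ∀ q : B, τ q = z q} / P {τ | τ c = x ∧ ∀ q : B, τ q = z q} *
        P {τ | ∀ q : B, τ q = z q} := by
  have hB : Measurable fun (τ : Trajectory 𝒳) (q : B) => τ q :=
    measurable_pi_lambda _ fun q => measurable_pi_apply _
  have hc : Measurable fun τ : Trajectory 𝒳 => (τ c, fun q : B => τ q) :=
    (measurable_pi_apply c).prodMk hB
  have hd : Measurable fun τ : Trajectory 𝒳 => τ d := measurable_pi_apply d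
  have e1 : ∀ z : (∀ q : B, 𝒳 q.1.1), (fun τ : Trajectory 𝒳 => (τ c, fun q : B => τ q)) ⁻¹' {(x, z)}
      = {τ | τ c = x ∧ ∀ q : B, τ q = z q} := by
    intro z; ext τ; simp [funext_iff]
  have e2 : ∀ z : (∀ q : B, 𝒳 q.1.1),
      (fun τ : Trajectory 𝒳 => ((τ c, fun q : B => τ q), τ d)) ⁻¹' ({(x, z)} ×ˢ {y})
      = {τ | τ d = y ∧ τ c = x ∧ ∀ q : B, τ q = z q} := by
    intro z; ext τ; simp [funext_iff]; tauto
  have e3 : ∀ z : (∀ q : B, 𝒳 q.1.1), (fun (τ : Trajectory 𝒳) (q : B) => τ q) ⁻¹' {z}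
      = {τ | ∀ q : B, τ q = z q} := by
    intro z; ext τ; simp [funext_iff]
  rw [adjustmentFormula, Measure.bind_apply (measurableSet_singleton y)
    (by exact ((Kernel.measurable _).comp measurable_prodMk_left).aemeasurable),
    lintegral_countable']
  refine tsum_congr fun z => ?_
  have h0 : P.map (fun τ : Trajectory 𝒳 => (τ c, fun q : B => τ q)) {(x, z)} ≠ 0 := by
    rw [Measure.map_apply hc (measurableSet_singleton _), e1]; exact hpos z
  rw [condDistrib_apply_of_ne_zero hd _ h0, Measure.map_apply hc (measurableSet_singleton _),
    Measure.map_apply hB (measurableSet_singleton _),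
    Measure.map_apply (hc.prodMk hd) ((measurableSet_singleton _).prod (measurableSet_singleton _)),
    e1, e2, e3, ENNReal.div_eq_inv_mul]

variable [Finite ι] [∀ i, StandardBorelSpace (𝒳 i)] [∀ i, Nonempty (𝒳 i)]

/-- `P(y | do(x))`, for the vertices `c` of `x` and `d` of `y`, is identifiable in `Ge`: one and the
same functional `Φ` of the observational law computes it in all models with positive law over all
candidate full-time causal graphs. Densities and conditional laws being defined up to null sets,
this is for almost all `x` (all `x`, in the discrete case with counting measure). -/
def IsIdentifiable (γmax : ℕ) (ν : ∀ i, Measure (𝒳 i)) (Ge : Digraph (ESCGVertex ι))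
    (c d : ι × ℤ) : Prop :=
  ∃ Φ : Measure (Trajectory 𝒳) → 𝒳 c.1 → Measure (𝒳 d.1),
    ∀ G ∈ candidateFTCGs γmax Ge, ∀ M : DSCM.{u, v, w} G 𝒳, IsPositiveLaw ν M.obsLaw →
      ∀ᵐ x ∂(ν c.1), M.totalEffect c d x = Φ M.obsLaw x

/-- `B` is a valid adjustment set for `P(y | do(x))`, for the vertices `c` of `x` and `d` of `y`: the
adjustment formula holds in all models with positive law over all candidate full-time causal
graphs of `Ge`. -/
def IsValidAdjustmentSet (γmax : ℕ) (ν : ∀ i, Measure (𝒳 i)) (Ge : Digraph (ESCGVertex ι))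
    (c d : ι × ℤ) (B : Set (ι × ℤ)) : Prop :=
  ∀ G ∈ candidateFTCGs γmax Ge, ∀ M : DSCM.{u, v, w} G 𝒳, IsPositiveLaw ν M.obsLaw →
    ∀ᵐ x ∂(ν c.1), M.totalEffect c d x = adjustmentFormula M.obsLaw c d B x

end

/-- The set `B_γ` attached to `P(y_t | do(x_{t-γ}))`: all the `Z_{t-γ-ℓ}`, `1 ≤ ℓ ≤ γmax`, for the
lagged parents `Z_{t⁻}` of `X_t`, and the `Z_{t-γ}` for the instantaneous parents `Z_t` of `X_t`. -/
def adjustmentB {ι : Type u} (γmax : ℕ) (Ge : Digraph (ESCGVertex ι)) (X : ι) (t : ℤ) (γ : ℕ) :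
    Set (ι × ℤ) :=
  {q | ∃ Z, Ge.Adj (.past Z) (.present X) ∧ ∃ ℓ : ℕ, 1 ≤ ℓ ∧ ℓ ≤ γmax ∧ q = (Z, t - γ - ℓ)} ∪
  {q | ∃ Z, Ge.Adj (.present Z) (.present X) ∧ q = (Z, t - γ)}

/-! Write c for the vertex of X_{t-γ}, and let Q collect the observed variables before the time of c
and all noise from then on except that of c. The noise U of c is independent of Q, almost surely Y =
g(X, Q), and do(x) produces the law of g(x, Q). In every candidate graph the variables B of
`adjustmentB` are nondescendants of c, hence almost surely a function b(Q), and they include all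
parents of c, so X = F(b(Q), U).

Given Q, the law of X thus depends on b(Q) alone. Positivity supplies a density σ of P_X ⊗ P_B with
respect to P_(X,B), and by `prod_map_eq_withDensity_of_indepFun` the same σ turns P_(X,Q) into P_X ⊗
P_Q. So E[σ(X, B) φ(X, Y)] computes the integral over P_X of both the interventional law and the
adjustment formula (`ae_map_eq_bind_of_indepFun`). They agree for P_X-almost every x, hence, again
by positivity, for ν_X-almost every x. Identifiability follows because the formula involves only P
and B, and B is read off Ge. -/

/-! ### Back-door adjustment for measurable functional models -/

section Adjustment

variable {Ω A E D R N : Type*} [MeasurableSpace Ω] [MeasurableSpace A] [MeasurableSpace E]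
  [MeasurableSpace D] [MeasurableSpace R] [MeasurableSpace N] {μ : Measure Ω}
  [IsProbabilityMeasure μ]

/-- If `X` is a function of `b ∘ Q` and of a variable `U` independent of `Q`, then the density of the
product of the laws of `X` and `b ∘ Q` with respect to their joint law is also the density of the
product of the laws of `X` and `Q` with respect to their joint law. -/
theorem prod_map_eq_withDensity_of_indepFun {X : Ω → A} {Q : Ω → R} {U : Ω → N} {b : R → E}
    {F : E × N → A} (hQ : Measurable Q) (hU : Measurable U) (hX : Measurable X)
    (hb : Measurable b) (hF : Measurable F) (hind : IndepFun Q U μ)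
    (hXF : ∀ᵐ ω ∂μ, X ω = F (b (Q ω), U ω)) {σ : A × E → ENNReal} (hσ : Measurable σ)
    (hσμ : (μ.map X).prod (μ.map (b ∘ Q)) = (μ.map fun ω => (X ω, b (Q ω))).withDensity σ) :
    (μ.map X).prod (μ.map Q) =
      (μ.map fun ω => (X ω, Q ω)).withDensity fun p => σ (p.1, b p.2) := by
  have : IsProbabilityMeasure (μ.map X) := Measure.isProbabilityMeasure_map hX.aemeasurable
  have : IsProbabilityMeasure (μ.map Q) := Measure.isProbabilityMeasure_map hQ.aemeasurable
  have : IsProbabilityMeasure (μ.map U) := Measure.isProbabilityMeasure_map hU.aemeasurable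
  have hbQ : Measurable (b ∘ Q) := hb.comp hQ
  have : IsProbabilityMeasure (μ.map (b ∘ Q)) :=
    Measure.isProbabilityMeasure_map hbQ.aemeasurable
  refine Measure.prod_eq fun s t hs ht => ?_
  -- The integral of σ(·, e) over s against the law of F(e, U), which is the conditional law of X
  -- given b(Q) = e. The goal reduces to h being almost everywhere the constant P_X(s).
  let h : E → ENNReal := fun e => ∫⁻ u, s.indicator (fun x => σ (x, e)) (F (e, u)) ∂(μ.map U)
  have hmeas : Measurable fun q : A × E => s.indicator (fun x => σ (x, q.2)) q.1 := by
    have : (fun q : A × E => s.indicator (fun x => σ (x, q.2)) q.1)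
        = (Prod.fst ⁻¹' s).indicator σ := by
      ext q; by_cases hq : q.1 ∈ s <;> simp [hq]
    rw [this]
    exact hσ.indicator (measurable_fst hs)
  have hmeas2 : Measurable fun q : E × N => s.indicator (fun x => σ (x, q.1)) (F q) :=
    hmeas.comp (hF.prodMk measurable_fst)
  have hh : Measurable h := hmeas2.lintegral_prod_right'
  -- The weight ψ may depend on all of Q: functions of b(Q) determine h, and general ones then give
  -- the claim.
  have key : ∀ ψ : R → ENNReal, Measurable ψ →
      ∫⁻ ω, ψ (Q ω) * s.indicator (fun x => σ (x, b (Q ω))) (X ω) ∂μ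
        = ∫⁻ r, ψ r * h (b r) ∂(μ.map Q) := by
    intro ψ hψ
    have hm : Measurable fun p : R × N =>
        ψ p.1 * s.indicator (fun x => σ (x, b p.1)) (F (b p.1, p.2)) :=
      (hψ.comp measurable_fst).mul
        (hmeas2.comp ((hb.comp measurable_fst).prodMk measurable_snd))
    calc _ = ∫⁻ ω, ψ (Q ω) * s.indicator (fun x => σ (x, b (Q ω))) (F (b (Q ω), U ω)) ∂μ := by
          refine lintegral_congr_ae ?_
          filter_upwards [hXF] with ω hω
          rw [hω]
      _ = ∫⁻ p, ψ p.1 * s.indicator (fun x => σ (x, b p.1)) (F (b p.1, p.2))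
            ∂(μ.map fun ω => (Q ω, U ω)) := (lintegral_map hm (hQ.prodMk hU)).symm
      _ = _ := by
          rw [(indepFun_iff_map_prod_eq_prod_map_map hQ.aemeasurable hU.aemeasurable).1 hind,
            lintegral_prod _ hm.aemeasurable]
          refine lintegral_congr fun r => ?_
          exact lintegral_const_mul (ψ r) (hmeas2.fun_comp (measurable_prodMk_left (x := b r)))
  -- With ψ the indicator of b⁻¹(t'), the defining property of σ on s × t' evaluates the integral of
  -- h over t' as P_X(s) P_{b(Q)}(t').
  have hconst : h =ᵐ[μ.map (b ∘ Q)] fun _ => μ.map X s := by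
    refine ae_eq_of_forall_setLIntegral_eq_of_sigmaFinite hh measurable_const fun t' ht' _ => ?_
    rw [setLIntegral_const, ← Measure.prod_prod, hσμ, withDensity_apply _ (hs.prod ht'),
      ← lintegral_indicator ht', lintegral_map (hh.indicator ht') hbQ,
      ← lintegral_indicator (hs.prod ht'),
      lintegral_map (hσ.indicator (hs.prod ht')) (hX.prodMk (hb.fun_comp hQ))]
    have := key ((b ⁻¹' t').indicator 1) (measurable_one.indicator (hb ht'))
    rw [lintegral_map ((measurable_one.indicator (hb ht')).fun_mul (hh.fun_comp hb)) hQ] at this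
    convert this.symm using 3 with ω ω
    · by_cases h1 : b (Q ω) ∈ t' <;> simp [h1]
    · by_cases h1 : b (Q ω) ∈ t' <;> by_cases h2 : X ω ∈ s <;> simp [h1, h2]
  have hσb : Measurable fun p : A × R => σ (p.1, b p.2) :=
    hσ.comp (measurable_fst.prodMk (hb.comp measurable_snd))
  rw [withDensity_apply _ (hs.prod ht), ← lintegral_indicator (hs.prod ht),
    lintegral_map (hσb.indicator (hs.prod ht)) (hX.prodMk hQ)]
  have h1 := key (t.indicator 1) (measurable_one.indicator ht)
  have h2 : ∫⁻ r, t.indicator 1 r * h (b r) ∂(μ.map Q)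
      = ∫⁻ r, t.indicator 1 r * μ.map X s ∂(μ.map Q) := by
    refine lintegral_congr_ae ?_
    have : ∀ᵐ r ∂(μ.map Q), h (b r) = μ.map X s := by
      rw [← Measure.map_map hb hQ] at hconst
      exact ae_of_ae_map hb.aemeasurable hconst
    filter_upwards [this] with r hr
    rw [hr]
  rw [h2, lintegral_mul_const _ (measurable_one.indicator ht), lintegral_indicator_one ht,
    mul_comm] at h1
  rw [← h1]
  refine lintegral_congr fun ω => ?_
  by_cases h1 : Q ω ∈ t <;> by_cases h2 : X ω ∈ s <;> simp [h1, h2]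

/-- The back-door adjustment formula for measurable functional models: `Y = g (X, Q)`, where `X` is
generated from `b ∘ Q` and a noise `U` independent of `Q`. The law of `g (x, Q)` is the mixture over
the law of `b ∘ Q` of the conditional laws `η` of `Y` given `X` and `b ∘ Q`. -/
theorem ae_map_eq_bind_of_indepFun [MeasurableSpace.CountablyGenerated D]
    {X : Ω → A} {B : Ω → E} {Y : Ω → D} {Q : Ω → R} {U : Ω → N} {b : R → E}
    {F : E × N → A} {g : A × R → D}
    (hX : Measurable X) (hB : Measurable B) (hY : Measurable Y) (hQ : Measurable Q)
    (hU : Measurable U) (hb : Measurable b) (hF : Measurable F) (hg : Measurable g)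
    (hind : IndepFun Q U μ) (hXF : ∀ᵐ ω ∂μ, X ω = F (b (Q ω), U ω))
    (hBb : ∀ᵐ ω ∂μ, B ω = b (Q ω)) (hYg : ∀ᵐ ω ∂μ, Y ω = g (X ω, Q ω))
    (hac : (μ.map X).prod (μ.map B) ≪ μ.map fun ω => (X ω, B ω))
    (η : Kernel (A × E) D) [IsMarkovKernel η]
    (hη : μ.map (fun ω => ((X ω, B ω), Y ω)) = (μ.map fun ω => (X ω, B ω)) ⊗ₘ η) :
    ∀ᵐ x ∂(μ.map X), μ.map (fun ω => g (x, Q ω)) = (μ.map B).bind fun z => η (x, z) := by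
  have : IsProbabilityMeasure (μ.map X) := Measure.isProbabilityMeasure_map hX.aemeasurable
  have : IsProbabilityMeasure (μ.map B) := Measure.isProbabilityMeasure_map hB.aemeasurable
  have : IsProbabilityMeasure (μ.map Q) := Measure.isProbabilityMeasure_map hQ.aemeasurable
  have hXB : Measurable fun ω => (X ω, B ω) := hX.prodMk hB
  have : IsProbabilityMeasure (μ.map fun ω => (X ω, B ω)) :=
    Measure.isProbabilityMeasure_map hXB.aemeasurable
  let σ := ((μ.map X).prod (μ.map B)).rnDeriv (μ.map fun ω => (X ω, B ω))
  have hσ : Measurable σ := Measure.measurable_rnDeriv _ _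
  have hσμ : (μ.map X).prod (μ.map B) = (μ.map fun ω => (X ω, B ω)).withDensity σ :=
    (Measure.withDensity_rnDeriv_eq _ _ hac).symm
  have e1 : μ.map B = μ.map (b ∘ Q) := Measure.map_congr hBb
  have e2 : (μ.map fun ω => (X ω, B ω)) = μ.map fun ω => (X ω, b (Q ω)) :=
    Measure.map_congr (by filter_upwards [hBb] with ω hω; rw [hω])
  have hσQ := prod_map_eq_withDensity_of_indepFun hQ hU hX hb hF hind hXF hσ
    (by rw [← e1, ← e2]; exact hσμ)
  -- The interventional laws and the adjusted mixtures as kernels in x; equality almost everywhere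
  -- is tested by integrating both against P_X.
  let κ₁ : Kernel A D := (Kernel.id ×ₖ Kernel.const A (μ.map Q)).map g
  let κ₂ : Kernel A D := η ∘ₖ (Kernel.id ×ₖ Kernel.const A (μ.map B))
  have : IsMarkovKernel κ₁ := Kernel.IsMarkovKernel.map _ hg
  have hκ₁ : ∀ x, κ₁ x = μ.map fun ω => g (x, Q ω) := by
    intro x
    rw [Kernel.map_apply _ hg, Kernel.prod_apply, Kernel.id_apply, Kernel.const_apply,
      Measure.dirac_prod, Measure.map_map hg measurable_prodMk_left,
      Measure.map_map (hg.comp measurable_prodMk_left) hQ]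
    rfl
  have hκ₂ : ∀ x, κ₂ x = (μ.map B).bind fun z => η (x, z) := by
    intro x
    ext s hs
    rw [Kernel.comp_apply, Kernel.prod_apply, Kernel.id_apply, Kernel.const_apply,
      Measure.dirac_prod, Measure.bind_apply hs η.aemeasurable,
      lintegral_map (η.measurable_coe hs) measurable_prodMk_left,
      Measure.bind_apply hs (η.measurable.fun_comp measurable_prodMk_left).aemeasurable]
  have main : μ.map X ⊗ₘ κ₁ = μ.map X ⊗ₘ κ₂ := by
    refine Measure.ext_of_lintegral _ fun φ hφ => ?_
    have hφg : Measurable fun p : A × R => φ (p.1, g p) := hφ.comp (measurable_fst.prodMk hg)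
    have hφ2 : Measurable fun p : (A × E) × D => φ (p.1.1, p.2) :=
      hφ.comp (measurable_fst.fst.prodMk measurable_snd)
    have hφη : Measurable fun p : A × E => ∫⁻ y, φ (p.1, y) ∂(η p) :=
      Measurable.lintegral_kernel_prod_right' hφ2
    have l1 : ∫⁻ p, φ p ∂(μ.map X ⊗ₘ κ₁) = ∫⁻ p, φ (p.1, g p) ∂((μ.map X).prod (μ.map Q)) := by
      rw [Measure.lintegral_compProd hφ, lintegral_prod _ hφg.aemeasurable]
      refine lintegral_congr fun x => ?_
      rw [hκ₁, lintegral_map (hφ.fun_comp measurable_prodMk_left)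
        (hg.fun_comp (measurable_const.prodMk hQ)),
        lintegral_map (hφg.fun_comp measurable_prodMk_left) hQ]
    have l2 : ∫⁻ p, φ p ∂(μ.map X ⊗ₘ κ₂)
        = ∫⁻ p, (∫⁻ y, φ (p.1, y) ∂(η p)) ∂((μ.map X).prod (μ.map B)) := by
      rw [Measure.lintegral_compProd hφ, lintegral_prod _ hφη.aemeasurable]
      refine lintegral_congr fun x => ?_
      rw [hκ₂, Measure.lintegral_bind (η.measurable.fun_comp measurable_prodMk_left).aemeasurable
        (hφ.fun_comp measurable_prodMk_left).aemeasurable]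
    have hσb : Measurable fun p : A × R => σ (p.1, b p.2) :=
      hσ.comp (measurable_fst.prodMk (hb.comp measurable_snd))
    rw [l1, l2, hσQ, lintegral_withDensity_eq_lintegral_mul _ hσb hφg,
      lintegral_map (hσb.mul hφg) (hX.prodMk hQ), hσμ,
      lintegral_withDensity_eq_lintegral_mul _ hσ hφη]
    -- E[σ(X, B) φ(X, Y)], disintegrated along η: the common value of the two integrals.
    have l3 := lintegral_map (μ := μ) ((hσ.comp measurable_fst).mul hφ2) (hXB.prodMk hY)
    rw [hη, Measure.lintegral_compProd ((hσ.comp measurable_fst).mul hφ2)] at l3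
    calc _ = ∫⁻ ω, σ (X ω, B ω) * φ (X ω, Y ω) ∂μ := by
          refine lintegral_congr_ae ?_
          filter_upwards [hBb, hYg] with ω h1 h2
          simp only [Pi.mul_apply, h1, h2]
      _ = _ := l3.symm
      _ = _ := by
          refine lintegral_congr fun p => ?_
          simp only [Pi.mul_apply, Function.comp]
          rw [lintegral_const_mul]
          exact hφ.comp measurable_prodMk_left
  filter_upwards [Kernel.ae_eq_of_compProd_eq main] with x hx
  rw [← hκ₁, ← hκ₂, hx]

end Adjustment

/-! ### Regrouping independent variables -/

section Independence

variable {Ω : Type*} [MeasurableSpace Ω] {μ : Measure Ω}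

/-- If `U` is independent of `W`, and `(U, W)` is independent of `Z`, then `(W, Z)` is independent
of `U`. -/
theorem ProbabilityTheory.IndepFun.prodMk_indepFun_of_prodMk [IsProbabilityMeasure μ]
    {α β δ : Type*} [MeasurableSpace α]
    [MeasurableSpace β] [MeasurableSpace δ] {U : Ω → α} {W : Ω → β} {Z : Ω → δ}
    (hU : Measurable U) (hW : Measurable W) (hZ : Measurable Z) (h : IndepFun U W μ)
    (h' : IndepFun (fun ω => (U ω, W ω)) Z μ) : IndepFun (fun ω => (W ω, Z ω)) U μ := by
  have : IsProbabilityMeasure (μ.map U) := Measure.isProbabilityMeasure_map hU.aemeasurable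
  have : IsProbabilityMeasure (μ.map W) := Measure.isProbabilityMeasure_map hW.aemeasurable
  have : IsProbabilityMeasure (μ.map Z) := Measure.isProbabilityMeasure_map hZ.aemeasurable
  have hWZ : IndepFun W Z μ := h'.comp (φ := Prod.snd) (ψ := id) measurable_snd measurable_id
  refine IndepFun.symm ?_
  rw [indepFun_iff_map_prod_eq_prod_map_map hU.aemeasurable (hW.prodMk hZ).aemeasurable,
    (indepFun_iff_map_prod_eq_prod_map_map hW.aemeasurable hZ.aemeasurable).1 hWZ,
    ← Measure.prodAssoc_prod,
    ← (indepFun_iff_map_prod_eq_prod_map_map hU.aemeasurable hW.aemeasurable).1 h,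
    ← (indepFun_iff_map_prod_eq_prod_map_map (hU.prodMk hW).aemeasurable hZ.aemeasurable).1 h',
    Measure.map_map MeasurableEquiv.prodAssoc.measurable ((hU.prodMk hW).prodMk hZ)]
  rfl

/-- In an independent family, a member is independent of the family of all the others. -/
theorem ProbabilityTheory.iIndepFun.indepFun_compl {κ : Type*} {β : κ → Type*}
    [∀ k, MeasurableSpace (β k)]
    {f : ∀ k, Ω → β k} (hf : ∀ k, Measurable (f k)) (h : iIndepFun f μ) (c : κ) :
    IndepFun (f c) (fun ω (k : {k // k ≠ c}) => f k.1 ω) μ := by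
  have h1 := indep_iSup_of_disjoint (fun k => (hf k).comap_le) h.iIndep
    (S := {c}) (T := {k | k ≠ c}) (by simp)
  rw [IndepFun_iff_Indep]
  refine indep_of_indep_of_le_left (indep_of_indep_of_le_right h1 ?_) ?_
  · rw [MeasurableSpace.pi, MeasurableSpace.comap_iSup]
    refine iSup_le fun k => ?_
    rw [MeasurableSpace.comap_comp]
    exact le_iSup₂_of_le k.1 k.2 le_rfl
  · exact le_iSup₂_of_le c rfl le_rfl

end Independence

/-! ### Interventions in a dynamic structural causal model -/

namespace DSCM

variable {ι : Type u} {γmax : ℕ} {G : FTCG ι γmax} {𝒳 : ι → Type v}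
  [∀ i, MeasurableSpace (𝒳 i)] (M : DSCM.{u, v, w} G 𝒳)

/-- The noise of the variable at `c` is independent of the observed variables before the time of `c`
together with the other noise variables from then on. -/
theorem indepFun_noise (c : ι × ℤ) :
    IndepFun (fun ω => (fun q : {q : {q : ι × ℤ // c.2 ≤ q.2} // q ≠ ⟨c, le_rfl⟩} => M.U q.1.1 ω,
      fun q : {q : ι × ℤ // q.2 < c.2} => M.V q.1 ω)) (M.U c) M.μ := by
  have h1 : iIndepFun (fun (q : {q : ι × ℤ // c.2 ≤ q.2}) => M.U q.1) M.μ :=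
    M.iIndepFun_U.precomp Subtype.val_injective
  have h2 := h1.indepFun_compl (fun q => M.measurable_U q.1) ⟨c, le_rfl⟩
  refine h2.prodMk_indepFun_of_prodMk (M.measurable_U c)
    (measurable_pi_lambda _ fun q => M.measurable_U _)
    (measurable_pi_lambda _ fun q => M.measurable_V _) ?_
  exact (M.indepFun_past c.2).comp
    (φ := fun n => (n ⟨c, le_rfl⟩,
      fun q : {q : {q : ι × ℤ // c.2 ≤ q.2} // q ≠ ⟨c, le_rfl⟩} => n q.1))
    (ψ := id) (by fun_prop) measurable_id

variable [Finite ι]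

theorem intervene_self (c : ι × ℤ) (x : 𝒳 c.1) (past : Trajectory 𝒳)
    (noise : Trajectory M.Noise) : M.intervene c x past noise c = x := by
  rw [intervene, WellFounded.fix_eq]
  simp

theorem intervene_of_lt {c q : ι × ℤ} (h : q.2 < c.2) (x : 𝒳 c.1) (past : Trajectory 𝒳)
    (noise : Trajectory M.Noise) : M.intervene c x past noise q = past q := by
  have hq : q ≠ c := by rintro rfl; exact lt_irrefl _ h
  rw [intervene, WellFounded.fix_eq]
  simp [hq, h]

/-- The case split of the recursion on parents before the time of c disappears, because the
intervened trajectory equals the given past there. -/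
theorem intervene_of_ne {c q : ι × ℤ} (hq : q ≠ c) (h : c.2 ≤ q.2) (x : 𝒳 c.1)
    (past : Trajectory 𝒳) (noise : Trajectory M.Noise) :
    M.intervene c x past noise q =
      M.mechanism q.1 (fun p => M.intervene c x past noise (p.1.1, q.2 - p.1.2)) (noise q) := by
  conv_lhs => rw [intervene, WellFounded.fix_eq]
  rw [dif_neg hq, if_neg h.not_gt]
  congr 1
  funext p
  split_ifs with hp
  · rfl
  · exact (M.intervene_of_lt (q := (p.1.1, q.2 - p.1.2)) (not_le.1 hp) x past noise).symm

/-- Induction along the edges from the time of `c` on. -/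
theorem intervene_induction (c : ι × ℤ) {p : ι × ℤ → Prop} (self : p c)
    (past : ∀ q, q.2 < c.2 → p q)
    (step : ∀ q, q ≠ c → c.2 ≤ q.2 → (∀ r : G.Parent q.1, p (r.1.1, q.2 - r.1.2)) → p q)
    (q : ι × ℤ) : p q := by
  induction q using (G.wellFounded_from c.2).induction with
  | _ q ih =>
    by_cases hq : q = c
    · exact hq ▸ self
    · rcases lt_or_ge q.2 c.2 with h | h
      · exact past q h
      · refine step q hq h fun r => ?_
        by_cases hr : c.2 ≤ q.2 - r.1.2
        · exact ih _ ⟨G.adj_of_parent r q.2, hr⟩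
        · exact past _ (not_le.1 hr)

theorem measurable_intervene (c q : ι × ℤ) :
    Measurable fun p : 𝒳 c.1 × Trajectory 𝒳 × Trajectory M.Noise =>
      M.intervene c p.1 p.2.1 p.2.2 q := by
  induction q using intervene_induction (G := G) c with
  | self => simpa only [intervene_self] using measurable_fst
  | past q h =>
    simp only [M.intervene_of_lt h]
    exact (measurable_pi_apply q).comp measurable_snd.fst
  | step q hq h ih =>
    simp only [M.intervene_of_ne hq h]
    exact (M.measurable_mechanism q.1).comp ((measurable_pi_lambda _ ih).prodMk
      ((measurable_pi_apply q).comp measurable_snd.snd))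

/-- The trajectory under an intervention only depends on the past before the intervention and on
the noise of the other variables from then on. -/
theorem intervene_congr (c : ι × ℤ) (x : 𝒳 c.1) {past past' : Trajectory 𝒳}
    {noise noise' : Trajectory M.Noise} (hpast : ∀ q : ι × ℤ, q.2 < c.2 → past q = past' q)
    (hnoise : ∀ q : ι × ℤ, c.2 ≤ q.2 → q ≠ c → noise q = noise' q) (q : ι × ℤ) :
    M.intervene c x past noise q = M.intervene c x past' noise' q := by
  induction q using intervene_induction (G := G) c with
  | self => rw [intervene_self, intervene_self]
  | past q h => rw [M.intervene_of_lt h, M.intervene_of_lt h, hpast q h]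
  | step q hq h ih =>
    rw [M.intervene_of_ne hq h, M.intervene_of_ne hq h, hnoise q h hq]
    simp only [ih]

/-- Consistency: holding the variable at `c` at some value does not change the nondescendants of
`c`, and changes nothing if it is the value that the variable takes. -/
theorem intervene_eq_of_structural_eq (c : ι × ℤ) (x : 𝒳 c.1) {τ : Trajectory 𝒳}
    {noise : Trajectory M.Noise} (hτ : ∀ (i : ι) (s : ℤ),
      τ (i, s) = M.mechanism i (fun p => τ (p.1.1, s - p.1.2)) (noise (i, s)))
    (q : ι × ℤ) (hq : x = τ c ∨ ¬ Relation.ReflTransGen G.Adj c q) :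
    M.intervene c x τ noise q = τ q := by
  induction q using intervene_induction (G := G) c with
  | self => rw [intervene_self]; exact hq.resolve_right fun h => h .refl
  | past q h => rw [M.intervene_of_lt h]
  | step q hqc h ih =>
    rw [M.intervene_of_ne hqc h, hτ q.1 q.2]
    congr 1
    funext p
    exact ih p (hq.imp_right fun h' h'' => h' (h''.tail (G.adj_of_parent p q.2)))

theorem ae_structural_eq : ∀ᵐ ω ∂M.μ, ∀ (i : ι) (s : ℤ),
    M.V (i, s) ω = M.mechanism i (fun p => M.V (p.1.1, s - p.1.2) ω) (M.U (i, s) ω) := by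
  rw [ae_all_iff]
  exact fun i => ae_all_iff.2 fun s => M.structural_eq i s

end DSCM

/-! ### Consequences of positivity -/

theorem measurable_restrict_trajectory {ι : Type u} {𝒳 : ι → Type v}
    [∀ i, MeasurableSpace (𝒳 i)] (S : Set (ι × ℤ)) :
    Measurable fun (τ : Trajectory 𝒳) (q : S) => τ q :=
  measurable_pi_lambda _ fun q => measurable_pi_apply q.1

namespace IsPositiveLaw

variable {ι : Type u} {𝒳 : ι → Type v} [∀ i, MeasurableSpace (𝒳 i)]
  {ν : ∀ i, Measure (𝒳 i)} {P : Measure (Trajectory 𝒳)}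

theorem absolutelyContinuous_map_eval (h : IsPositiveLaw ν P) (c : ι × ℤ) :
    ν c.1 ≪ P.map (fun τ => τ c) := by
  have hc : Measurable fun z : (∀ q : ({c} : Set (ι × ℤ)), 𝒳 q.1.1) => z ⟨c, rfl⟩ :=
    measurable_pi_apply _
  have h1 := (h {c}).2.map hc
  rw [Measure.map_map hc (measurable_restrict_trajectory {c})] at h1
  have h2 := (measurePreserving_piUnique fun q : ({c} : Set (ι × ℤ)) => ν q.1.1).map_eq
  exact (Eq.symm h2).absolutelyContinuous.trans h1

variable [∀ i, SigmaFinite (ν i)]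

theorem map_eval_absolutelyContinuous (h : IsPositiveLaw ν P) (c : ι × ℤ) :
    P.map (fun τ => τ c) ≪ ν c.1 := by
  have hc : Measurable fun z : (∀ q : ({c} : Set (ι × ℤ)), 𝒳 q.1.1) => z ⟨c, rfl⟩ :=
    measurable_pi_apply _
  have h1 := (h {c}).1.map hc
  rw [Measure.map_map hc (measurable_restrict_trajectory {c})] at h1
  exact h1.trans (Measure.quasiMeasurePreserving_eval
    (μ := fun q : ({c} : Set (ι × ℤ)) => ν q.1.1) ⟨c, rfl⟩).absolutelyContinuous

-- Positivity concerns the single index set `insert c B`; the product of reference measures on it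
-- splits off the factor at c because c is not in B.
open Classical in
theorem prod_absolutelyContinuous (h : IsPositiveLaw ν P) {c : ι × ℤ} {B : Set (ι × ℤ)}
    [Fintype B] (hc : c ∉ B) :
    (ν c.1).prod (Measure.pi fun q : B => ν q.1.1) ≪
      P.map fun τ => (τ c, fun q : B => τ q) := by
  -- Gluing map with left inverse π. It carries the binary product to the product measure over
  -- `insert c B`, so pushing positivity forward along π gives the claim.
  let e : 𝒳 c.1 × (∀ q : B, 𝒳 q.1.1) → ∀ q : ↥(insert c B), 𝒳 q.1.1 := fun p q =>
    if hq : q.1 = c then cast (congrArg (fun r : ι × ℤ => 𝒳 r.1) hq.symm) p.1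
    else p.2 ⟨q.1, q.2.resolve_left hq⟩
  have he : Measurable e := by
    refine measurable_pi_lambda _ fun q => ?_
    obtain ⟨q, hq⟩ := q
    by_cases hqc : q = c
    · subst hqc
      simpa [e] using measurable_fst
    · simp only [e, hqc, dite_false]
      exact (measurable_pi_apply _).comp measurable_snd
  let π : (∀ q : ↥(insert c B), 𝒳 q.1.1) → 𝒳 c.1 × (∀ q : B, 𝒳 q.1.1) := fun z =>
    (z ⟨c, Set.mem_insert _ _⟩, fun q => z ⟨q.1, Set.mem_insert_of_mem _ q.2⟩)
  have hπ : Measurable π := by fun_prop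
  have hπe : π ∘ e = id := by
    funext p
    refine Prod.ext ?_ ?_
    · simp [π, e]
    · funext q
      have : q.1 ≠ c := fun hq => hc (hq ▸ q.2)
      simp [π, e, this]
  have hmap : Measure.pi (fun q : ↥(insert c B) => ν q.1.1) =
      ((ν c.1).prod (Measure.pi fun q : B => ν q.1.1)).map e := by
    refine Measure.pi_eq fun s hs => ?_
    rw [Measure.map_apply he (MeasurableSet.univ_pi hs)]
    have : e ⁻¹' Set.univ.pi s = s ⟨c, Set.mem_insert _ _⟩ ×ˢ
        Set.univ.pi (fun q : B => s ⟨q.1, Set.mem_insert_of_mem _ q.2⟩) := by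
      ext p
      have h1 := congrFun hπe p
      have h2 : (e p) ⟨c, Set.mem_insert _ _⟩ = p.1 := congrArg Prod.fst h1
      have h3 : ∀ q : B, (e p) ⟨q.1, Set.mem_insert_of_mem _ q.2⟩ = p.2 q :=
        fun q => congrFun (congrArg Prod.snd h1) q
      simp only [Set.mem_preimage, Set.mem_univ_pi, Set.mem_prod, ← h2, ← h3]
      refine ⟨fun hp => ⟨hp _, fun q => hp _⟩, fun hp q => ?_⟩
      obtain ⟨q, rfl | hq⟩ := q
      · exact hp.1
      · exact hp.2 ⟨q, hq⟩
    rw [this, Measure.prod_prod, Measure.pi_pi]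
    let E : Option B ≃ ↥(insert c B) := (Equiv.optionEquivSumPUnit _).trans
      (Equiv.Set.insert hc).symm
    rw [← E.prod_comp, Fintype.prod_option]
    rfl
  have h1 := (h (insert c B)).2.map hπ
  rw [hmap, Measure.map_map hπ he, hπe, Measure.map_id, Measure.map_map hπ
    (measurable_restrict_trajectory _)] at h1
  exact h1

/-- The overlap condition under which the reweighting density σ exists. -/
theorem prod_map_absolutelyContinuous [IsFiniteMeasure P] (h : IsPositiveLaw ν P) {c : ι × ℤ}
    {B : Set (ι × ℤ)} [Fintype B] (hc : c ∉ B) :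
    (P.map fun τ => τ c).prod (P.map fun τ (q : B) => τ q) ≪
      P.map fun τ => (τ c, fun q : B => τ q) :=
  ((h.map_eval_absolutelyContinuous c).prod (h B).1).trans (h.prod_absolutelyContinuous hc)

end IsPositiveLaw

/-! ### The adjustment set in a candidate graph -/

section Graph

variable {ι : Type u} {γmax : ℕ}

theorem finite_adjustmentB [Finite ι] (Ge : Digraph (ESCGVertex ι)) (X : ι) (t : ℤ) (γ : ℕ) :
    (adjustmentB γmax Ge X t γ).Finite := by
  refine (Set.finite_univ.prod (Set.finite_Icc (t - γ - γmax) (t - γ))).subset ?_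
  rintro q (⟨Z, -, ℓ, h1, h2, rfl⟩ | ⟨Z, -, rfl⟩) <;> simp
  omega

/-- The ESCG forgets which lags occur, but the set takes every lag up to γmax of each lagged parent,
so it covers the true parents whatever the candidate. -/
theorem FTCG.parent_mem_adjustmentB (G : FTCG ι γmax) {X : ι} (p : G.Parent X) (t : ℤ) (γ : ℕ) :
    (p.1.1, t - γ - (p.1.2 : ℤ)) ∈ adjustmentB γmax G.toESCG X t γ := by
  obtain ⟨⟨Z, ℓ⟩, hp⟩ := p
  rcases Nat.eq_zero_or_pos ℓ with rfl | hℓ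
  · refine Or.inr ⟨Z, ?_, by simp⟩
    show G.Adj (Z, 0) (X, 0)
    simpa using hp
  · have hle : ℓ ≤ γmax := by simpa using G.lag_le hp
    exact Or.inl ⟨Z, ⟨ℓ, hℓ, hle, hp⟩, ℓ, hℓ, hle, rfl⟩

theorem FTCG.time_le_of_reflTransGen (G : FTCG ι γmax) {p q : ι × ℤ}
    (h : Relation.ReflTransGen G.Adj p q) : p.2 ≤ q.2 := by
  induction h with
  | refl => exact le_rfl
  | tail _ h ih => exact ih.trans (G.time_le h)

/-- Lagged members precede X_{t-γ} in time, whether or not they are true parents. Instantaneous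
members are true parents in every candidate, so acyclicity excludes them as descendants. -/
theorem FTCG.not_descendant_of_mem_adjustmentB (G : FTCG ι γmax) {X : ι} {t : ℤ} {γ : ℕ}
    {q : ι × ℤ} (hq : q ∈ adjustmentB γmax G.toESCG X t γ) :
    ¬ Relation.ReflTransGen G.Adj (X, t - γ) q := by
  intro h
  rcases hq with ⟨Z, -, ℓ, h1, -, rfl⟩ | ⟨Z, hZ, rfl⟩
  · have := G.time_le_of_reflTransGen h
    simp at this
    omega
  · have hZ' : G.Adj (Z, t - γ) (X, t - γ) := by
      have := G.shift (t - γ) (show G.Adj (Z, 0) (X, 0) from hZ)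
      simpa using this
    exact G.acyclic _ (Relation.TransGen.tail' h hZ')

end Graph

/-! ### Adjustment formula and identifiability -/

section Main

variable {ι : Type u} [Finite ι] {γmax : ℕ} {𝒳 : ι → Type v}
    [∀ i, MeasurableSpace (𝒳 i)] [∀ i, StandardBorelSpace (𝒳 i)] [∀ i, Nonempty (𝒳 i)]

open Classical in
/-- A finite set of nondescendants of `c` that contains the parents of `c` satisfies the adjustment
formula. -/
theorem DSCM.ae_totalEffect_eq_adjustmentFormula {G : FTCG ι γmax} (M : DSCM.{u, v, w} G 𝒳)
    {ν : ∀ i, Measure (𝒳 i)} [∀ i, SigmaFinite (ν i)] (hν : IsPositiveLaw ν M.obsLaw)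
    (c d : ι × ℤ) {B : Set (ι × ℤ)} (hfin : B.Finite)
    (hpar : ∀ p : G.Parent c.1, (p.1.1, c.2 - (p.1.2 : ℤ)) ∈ B)
    (hdesc : ∀ q ∈ B, ¬ Relation.ReflTransGen G.Adj c q) :
    ∀ᵐ x ∂(ν c.1), M.totalEffect c d x = adjustmentFormula M.obsLaw c d B x := by
  have hcB : c ∉ B := fun h => hdesc c h .refl
  have := hfin.fintype
  have hV : Measurable fun ω q => M.V q ω := measurable_pi_lambda _ M.measurable_V
  have : Nonempty M.Ω := nonempty_of_isProbabilityMeasure M.μ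
  have hN : ∀ q : ι × ℤ, Nonempty (M.Noise q.1) := fun q => this.map (M.U q)
  let x₀ : 𝒳 c.1 := Classical.arbitrary _
  -- the past before `c` and the noise from then on, except at `c`
  let Rest := (∀ q : {q : {q : ι × ℤ // c.2 ≤ q.2} // q ≠ ⟨c, le_rfl⟩}, M.Noise q.1.1.1) ×
    (∀ q : {q : ι × ℤ // q.2 < c.2}, 𝒳 q.1.1)
  let Q : M.Ω → Rest := fun ω => (fun q => M.U q.1.1 ω, fun q => M.V q.1 ω)
  -- The arbitrary values that fill up `past` and `noise` are never read by the intervention, by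
  -- `intervene_congr`.
  let past : Rest → Trajectory 𝒳 := fun r q =>
    if h : q.2 < c.2 then r.2 ⟨q, h⟩ else Classical.arbitrary _
  let noise : Rest → Trajectory M.Noise := fun r q =>
    if h : c.2 ≤ q.2 ∧ q ≠ c then r.1 ⟨⟨q, h.1⟩, fun h' => h.2 (congrArg Subtype.val h')⟩
    else Classical.arbitrary _
  have hQ : Measurable Q := (measurable_pi_lambda _ fun q => M.measurable_U _).prodMk
    (measurable_pi_lambda _ fun q => M.measurable_V _)
  have hpast : Measurable past := by
    refine measurable_pi_lambda _ fun q => ?_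
    by_cases h : q.2 < c.2
    · simp only [past, dif_pos h]
      exact (measurable_pi_apply _).comp measurable_snd
    · simpa only [past, h, dite_false] using measurable_const
  have hnoise : Measurable noise := by
    refine measurable_pi_lambda _ fun q => ?_
    by_cases h : c.2 ≤ q.2 ∧ q ≠ c
    · simp only [noise, dif_pos h]
      exact (measurable_pi_apply _).comp measurable_fst
    · simpa only [noise, h, dite_false] using measurable_const
  let g : ∀ q : ι × ℤ, 𝒳 c.1 × Rest → 𝒳 q.1 := fun q p => M.intervene c p.1 (past p.2) (noise p.2) q
  have hg : ∀ q, Measurable (g q) := fun q => (M.measurable_intervene c q).comp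
    (measurable_fst.prodMk ((hpast.comp measurable_snd).prodMk (hnoise.comp measurable_snd)))
  have hgQ : ∀ x ω q, g q (x, Q ω) = M.intervene c x (fun q => M.V q ω) (fun q => M.U q ω) q := by
    intro x ω q
    refine M.intervene_congr c x (fun q h => ?_) (fun q h h' => ?_) q
    · simp [past, Q, h]
    · simp [noise, Q, h, h']
  -- B may contain variables at the time of c, which are not coordinates of Q, so they are
  -- regenerated from past and noise. Holding c at the arbitrary x₀ is harmless, as B has no
  -- descendants of c.
  let b : Rest → ∀ q : B, 𝒳 q.1.1 := fun r q => g q (x₀, r)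
  have hb : Measurable b :=
    measurable_pi_lambda _ fun q => (hg q).comp measurable_prodMk_left
  let F : (∀ q : B, 𝒳 q.1.1) × M.Noise c.1 → 𝒳 c.1 := fun p =>
    M.mechanism c.1 (fun r => p.1 ⟨_, hpar r⟩) p.2
  have hF : Measurable F := by
    have h : Measurable fun p : (∀ q : B, 𝒳 q.1.1) × M.Noise c.1 =>
        ((fun r => p.1 ⟨_, hpar r⟩ : ∀ r : G.Parent c.1, 𝒳 r.1.1), p.2) :=
      (measurable_pi_lambda _ fun r =>
        (measurable_pi_apply (⟨_, hpar r⟩ : B)).comp measurable_fst).prodMk measurable_snd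
    exact (M.measurable_mechanism c.1).comp h
  have hBb : ∀ᵐ ω ∂M.μ, (fun q : B => M.V q ω) = b (Q ω) := by
    filter_upwards [M.ae_structural_eq] with ω hω
    funext q
    simp only [b, hgQ]
    exact (M.intervene_eq_of_structural_eq
      (τ := fun q => M.V q ω) (noise := fun q => M.U q ω) c x₀ hω q.1 (Or.inr (hdesc q q.2))).symm
  have hXF : ∀ᵐ ω ∂M.μ, M.V c ω = F (b (Q ω), M.U c ω) := by
    filter_upwards [M.ae_structural_eq, hBb] with ω hω hB
    rw [← hB]
    exact hω c.1 c.2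
  have hYg : ∀ᵐ ω ∂M.μ, M.V d ω = g d (M.V c ω, Q ω) := by
    filter_upwards [M.ae_structural_eq] with ω hω
    rw [hgQ]
    exact (M.intervene_eq_of_structural_eq
      (τ := fun q => M.V q ω) (noise := fun q => M.U q ω) c _ hω d (Or.inl rfl)).symm
  have hc' : Measurable fun τ : Trajectory 𝒳 => τ c := measurable_pi_apply c
  have hd' : Measurable fun τ : Trajectory 𝒳 => τ d := measurable_pi_apply d
  have hB' := measurable_restrict_trajectory (𝒳 := 𝒳) B
  have e1 : M.obsLaw.map (fun τ => τ c) = M.μ.map (M.V c) := Measure.map_map hc' hV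
  have e2 : M.obsLaw.map (fun τ (q : B) => τ q) = M.μ.map fun ω (q : B) => M.V q ω :=
    Measure.map_map hB' hV
  have e3 : M.obsLaw.map (fun τ => (τ c, fun q : B => τ q))
      = M.μ.map fun ω => (M.V c ω, fun q : B => M.V q ω) := Measure.map_map (hc'.prodMk hB') hV
  have e4 : M.obsLaw.map (fun τ => ((τ c, fun q : B => τ q), τ d))
      = M.μ.map fun ω => ((M.V c ω, fun q : B => M.V q ω), M.V d ω) :=
    Measure.map_map ((hc'.prodMk hB').prodMk hd') hV
  have hac := hν.prod_map_absolutelyContinuous hcB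
  have hη := compProd_map_condDistrib (μ := M.obsLaw) (mβ := inferInstance)
    (X := fun τ : Trajectory 𝒳 => (τ c, fun q : B => τ q)) hd'.aemeasurable
  rw [e1, e2, e3] at hac
  rw [e3, e4] at hη
  have key := ae_map_eq_bind_of_indepFun (M.measurable_V c)
    (measurable_pi_lambda _ fun q : B => M.measurable_V q.1) (M.measurable_V d) hQ
    (M.measurable_U c) hb hF (hg d) (M.indepFun_noise c) hXF hBb hYg hac _ hη.symm
  rw [← e1, ← e2] at key
  -- From P_X-almost every x to ν_X-almost every x, by ν_X ≪ P_X.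
  filter_upwards [(hν.absolutelyContinuous_map_eval c).ae_le key] with x hx
  rw [adjustmentFormula, ← hx, DSCM.totalEffect]
  simp only [hgQ]

theorem isValidAdjustmentSet_adjustmentB (ν : ∀ i, Measure (𝒳 i)) [∀ i, SigmaFinite (ν i)]
    (Ge : Digraph (ESCGVertex ι)) (X Y : ι) (t : ℤ) (γ : ℕ) :
    IsValidAdjustmentSet.{u, v, w} γmax ν Ge (X, t - γ) (Y, t) (adjustmentB γmax Ge X t γ) := by
  rintro G rfl M hM
  exact M.ae_totalEffect_eq_adjustmentFormula hM _ _ (finite_adjustmentB _ X t γ)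
    (fun p => G.parent_mem_adjustmentB p t γ) fun q hq => G.not_descendant_of_mem_adjustmentB hq

open Classical in
theorem IsValidAdjustmentSet.isIdentifiable {ν : ∀ i, Measure (𝒳 i)}
    {Ge : Digraph (ESCGVertex ι)} {c d : ι × ℤ} {B : Set (ι × ℤ)}
    (h : IsValidAdjustmentSet.{u, v, w} γmax ν Ge c d B) :
    IsIdentifiable.{u, v, w} γmax ν Ge c d := by
  -- The functional must accept every measure, while the formula needs a finite one; the value 0
  -- elsewhere never matters for observational laws.
  refine ⟨fun P x => if hP : IsFiniteMeasure P then adjustmentFormula P c d B x else 0,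
    fun G hG M hM => ?_⟩
  filter_upwards [h G hG M hM] with x hx
  rw [hx, dif_pos (inferInstanceAs (IsFiniteMeasure M.obsLaw))]

end Main

theorem mainTheorem1 {ι : Type u} [Finite ι] (γmax : ℕ) (𝒳 : ι → Type v)
    [∀ i, MeasurableSpace (𝒳 i)] [∀ i, StandardBorelSpace (𝒳 i)] [∀ i, Nonempty (𝒳 i)]
    (ν : ∀ i, Measure (𝒳 i)) [∀ i, SigmaFinite (ν i)]
    (Ge : Digraph (ESCGVertex ι)) (X Y : ι) (t : ℤ) (γ : ℕ) :
    IsIdentifiable.{u, v, w} γmax ν Ge (X, t - γ) (Y, t) ∧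
    IsValidAdjustmentSet.{u, v, w} γmax ν Ge (X, t - γ) (Y, t) (adjustmentB γmax Ge X t γ) := by
  exact ⟨(isValidAdjustmentSet_adjustmentB ν Ge X Y t γ).isIdentifiable,
    isValidAdjustmentSet_adjustmentB ν Ge X Y t γ⟩
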